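/- Let $\hat\theta_1,\hat\theta_2,\ldots$ be independent and identically distributed real random variables with $\mathbb E[\hat\theta_1^2]<\infty$ and variance $\mathbb V[\hat\theta_1]=\sigma^2$ (so $0\le\sigma^2<\infty$), and let $\alpha>0$ be fixed. For every $n\ge 1$ let $\mathbf p^{(n)}=(p^{(n)}_1,\ldots,p^{(n)}_n)$ be a random vector defined on the same probability space, independent of the sequence $(\hat\theta_i)_{i\ge1}$, with the symmetric Dirichlet distribution $\mathrm{Dir}_n(\alpha,\ldots,\alpha)$, that is, the distribution on the simplex $\{x_i\ge 0,\ x_1+\cdots+x_n=1\}$ with density $\frac{\Gamma(n\alpha)}{\Gamma(\alpha)^n}\prod_{i=1}^n x_i^{\alpha-1}$ with respect to Lebesgue measure $dx_1\cdots dx_{n-1}$ (for $n=1$, the point mass at $1$). Put $$Y_n=\sum_{i=1}^n p^{(n)}_i\hat\theta_i,\qquad \overline\theta_n=\frac1n\sum_{i=1}^n\hat\theta_i .$$ Then, for almost every sequence $(\hat\theta_1,\hat\theta_2,\ldots)$ (with respect to the law of the sequence), the regular conditional distribution of $\sqrt n\,(Y_n-\overline\theta_n)$ given $(\hat\theta_i)_{i\ge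 1}$ converges weakly, as $n\to\infty$, to the normal distribution $N(0,\sigma^2/\alpha)$ (the point mass at $0$ if $\sigma=0$). -/

import Mathlib

open MeasureTheory ProbabilityTheory Filter Topology
open scoped ENNReal NNReal

/-- The point of the hyperplane `∑ i, x i = 1` in `ℝ^(m+1)` with first `m` coordinates `y`. -/
noncomputable def simplexPoint {m : ℕ} (y : Fin m → ℝ) : Fin (m + 1) → ℝ :=
  Fin.snoc (α := fun _ => ℝ) y (1 - ∑ i, y i)

lemma measurable_simplexPoint {m : ℕ} :
    Measurable (simplexPoint : (Fin m → ℝ) → Fin (m + 1) → ℝ) := by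
  refine measurable_pi_lambda _ fun i => ?_
  refine Fin.lastCases ?_ (fun j => ?_) i
  · simp only [simplexPoint, Fin.snoc_last]
    fun_prop
  · simp only [simplexPoint, Fin.snoc_castSucc]
    fun_prop

/-- The Dirichlet density with parameters `a 0, …, a m`, as a function on the hyperplane
`∑ i, x i = 1`: it equals `Γ(∑ a i) / ∏ Γ(a i) * ∏ x i ^ (a i - 1)` on the open simplex
and `0` elsewhere. -/
noncomputable def dirichletPDF {m : ℕ} (a x : Fin (m + 1) → ℝ) : ℝ≥0∞ :=
  open Classical in
  if ∀ i, 0 < x i then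
    ENNReal.ofReal (Real.Gamma (∑ i, a i) / (∏ i, Real.Gamma (a i)) * ∏ i, x i ^ (a i - 1))
  else 0

/-- The Dirichlet distribution `Dir_{m+1}(a 0, …, a m)`: the law on the simplex in `ℝ^(m+1)` whose
first `m` coordinates have the Dirichlet density with respect to Lebesgue measure on `ℝ^m`.
For `m = 0` it is the point mass at `(1)`. -/
noncomputable def dirichletMeasure {m : ℕ} (a : Fin (m + 1) → ℝ) : Measure (Fin (m + 1) → ℝ) :=
  ((volume : Measure (Fin m → ℝ)).withDensity
    fun y => dirichletPDF a (simplexPoint y)).map simplexPoint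

/-- The sample mean of the first `n + 1` terms of a sequence. -/
noncomputable def sampleMean (n : ℕ) (x : ℕ → ℝ) : ℝ :=
  (∑ i : Fin (n + 1), x i) / (n + 1)

/-- The weighted mean `∑ i, p i * x i` of the first `n + 1` terms of a sequence. -/
noncomputable def weightedMean {n : ℕ} (p : Fin (n + 1) → ℝ) (x : ℕ → ℝ) : ℝ :=
  ∑ i : Fin (n + 1), p i * x i

/-! By independence, conditioning on the sample freezes it at a sequence `x` and leaves the
Dirichlet weights untouched (`condDistrib_ae_eq_map_of_indepFun`). By the strong law, almost every
`x` has convergent averages of `x i` and `x i ^ 2`, and nothing else about `x` is needed: the rest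
is a limit theorem for a deterministic sequence (`tendsto_map_dirichletMeasure`).

A symmetric Dirichlet vector is a vector of i.i.d. Gamma(α, 1) variables `g i` divided by their sum
(`map_div_sum_pi_gammaMeasure`). Since the deviations `x i - sampleMean n x` sum to zero, the `g i`
may be centered for free, and the statistic becomes `∑ w i * (g i - α) / √α` divided by the average
of the `g i`, with `w i = √α (x i - sampleMean n x) / √(n + 1)`
(`sqrt_mul_weightedMean_sub_sampleMean`). Here `max |w i| → 0` and `∑ w i ^ 2 → α σ²`, so the
numerator tends to N(0, α σ²) by `tendsto_charFun_weighted_sum`; the denominator tends to α, and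
Slutsky's theorem gives the variance α σ² / α² = σ² / α. The case σ = 0 needs no separate treatment.
-/

/-! ### Dirichlet vectors as normalized Gamma vectors -/

theorem lintegral_pi_prod {n : ℕ} {μ : Fin n → Measure ℝ} [∀ i, SigmaFinite (μ i)]
    {f : Fin n → ℝ → ℝ≥0∞} (hf : ∀ i, Measurable (f i)) :
    ∫⁻ x, ∏ i, f i (x i) ∂(Measure.pi μ) = ∏ i, ∫⁻ x, f i x ∂(μ i) := by
  induction n with
  | zero => simp
  | succ n ih =>
    have hmp := (measurePreserving_piFinSuccAbove μ 0).symm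
    rw [← hmp.lintegral_comp (by fun_prop), Fin.prod_univ_succ]
    simp only [Fin.succAbove_zero]
    rw [← ih (fun i => hf i.succ),
      ← lintegral_prod_mul (hf 0).aemeasurable (Finset.measurable_prod _ fun i _ =>
        (hf i.succ).comp (measurable_pi_apply i)).aemeasurable]
    refine lintegral_congr fun x => ?_
    simp [Fin.prod_univ_succ, MeasurableEquiv.piFinSuccAbove]

theorem pi_withDensity {n : ℕ} {f : Fin n → ℝ → ℝ≥0∞} (hf : ∀ i, Measurable (f i))
    [∀ i, SigmaFinite ((volume : Measure ℝ).withDensity (f i))] :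
    Measure.pi (fun i => (volume : Measure ℝ).withDensity (f i)) =
      (volume : Measure (Fin n → ℝ)).withDensity fun x => ∏ i, f i (x i) := by
  refine Measure.pi_eq fun s hs => ?_
  rw [withDensity_apply _ (.univ_pi hs), ← lintegral_indicator (.univ_pi hs)]
  have h : ∀ x : Fin n → ℝ, (Set.univ.pi s).indicator (fun x => ∏ i, f i (x i)) x =
      ∏ i, (s i).indicator (f i) (x i) := fun x => by
    by_cases hx : x ∈ Set.univ.pi s
    · rw [Set.indicator_of_mem hx]
      exact Finset.prod_congr rfl fun i _ => (Set.indicator_of_mem (hx i trivial) _).symm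
    · rw [Set.indicator_of_notMem hx]
      simp only [Set.mem_univ_pi, not_forall] at hx
      obtain ⟨i, hi⟩ := hx
      exact (Finset.prod_eq_zero (Finset.mem_univ i) (Set.indicator_of_notMem hi _)).symm
  simp_rw [h]
  rw [volume_pi, lintegral_pi_prod fun i => (hf i).indicator (hs i)]
  refine Finset.prod_congr rfl fun i _ => ?_
  rw [lintegral_indicator (hs i), withDensity_apply _ (hs i)]

theorem lintegral_eq_pow_mul_lintegral_smul {m : ℕ} {s : ℝ} (hs : 0 < s)
    {f : (Fin m → ℝ) → ℝ≥0∞} (hf : Measurable f) :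
    ∫⁻ y, f y = ENNReal.ofReal (s ^ m) * ∫⁻ y, f (s • y) := by
  have h := Measure.map_addHaar_smul (volume : Measure (Fin m → ℝ)) hs.ne'
  rw [← lintegral_map (f := f) hf (measurable_const_smul s), h, lintegral_smul_measure, smul_eq_mul,
    ← mul_assoc, ← ENNReal.ofReal_mul (by positivity), Module.finrank_fin_fun,
    abs_of_pos (by positivity), mul_inv_cancel₀ (by positivity), ENNReal.ofReal_one, one_mul]

theorem sum_simplexPoint {m : ℕ} (y : Fin m → ℝ) : ∑ i, simplexPoint y i = 1 := by
  simp [simplexPoint, Fin.sum_univ_castSucc]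

theorem smul_simplexPoint {m : ℕ} (s : ℝ) (y : Fin m → ℝ) :
    s • simplexPoint y = Fin.snoc (α := fun _ => ℝ) (s • y) (s - ∑ i, (s • y) i) := by
  funext i
  refine Fin.lastCases ?_ (fun j => ?_) i
  · simp [simplexPoint, ← Finset.mul_sum]
    ring
  · simp [simplexPoint]

theorem measurable_snoc {m : ℕ} :
    Measurable fun z : (Fin m → ℝ) × ℝ => Fin.snoc (α := fun _ => ℝ) z.1 z.2 := by
  refine measurable_pi_lambda _ fun i => ?_
  refine Fin.lastCases ?_ (fun j => ?_) i
  · simp only [Fin.snoc_last]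
    fun_prop
  · simp only [Fin.snoc_castSucc]
    fun_prop

/-- Integration of a function supported on `{∑ i, x i > 0}` along the hyperplanes
`{∑ i, x i = s}`. -/
theorem lintegral_eq_lintegral_smul_simplexPoint {m : ℕ} {F : (Fin (m + 1) → ℝ) → ℝ≥0∞}
    (hF : Measurable F) (h0 : ∀ x, ∑ i, x i ≤ 0 → F x = 0) :
    ∫⁻ x, F x = ∫⁻ s in Set.Ioi (0 : ℝ),
      ENNReal.ofReal (s ^ m) * ∫⁻ y : Fin m → ℝ, F (s • simplexPoint y) := by
  have hmp := (volume_preserving_piFinSuccAbove (fun _ : Fin (m + 1) => ℝ) (Fin.last m)).symm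
  have hsn : Measurable fun z : ℝ × (Fin m → ℝ) =>
      F (Fin.snoc (α := fun _ => ℝ) z.2 (z.1 - ∑ i, z.2 i)) :=
    hF.comp (measurable_snoc.comp (by fun_prop : Measurable fun z : ℝ × (Fin m → ℝ) =>
      (z.2, z.1 - ∑ i, z.2 i)))
  have hsn' : Measurable fun z : ℝ × (Fin m → ℝ) => F (Fin.snoc (α := fun _ => ℝ) z.2 z.1) :=
    hF.comp (measurable_snoc.comp measurable_swap)
  calc ∫⁻ x, F x = ∫⁻ z : ℝ × (Fin m → ℝ), F (Fin.snoc (α := fun _ => ℝ) z.2 z.1) := by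
        rw [← hmp.lintegral_comp hF]
        refine lintegral_congr fun z => ?_
        simp [MeasurableEquiv.piFinSuccAbove, Fin.snocEquiv]
    _ = ∫⁻ y : Fin m → ℝ, ∫⁻ t : ℝ, F (Fin.snoc (α := fun _ => ℝ) y t) :=
        lintegral_prod_symm' _ hsn'
    _ = ∫⁻ y : Fin m → ℝ, ∫⁻ s : ℝ, F (Fin.snoc (α := fun _ => ℝ) y (s - ∑ i, y i)) := by
        refine lintegral_congr fun y => ?_
        -- Translating the last coordinate makes `s` the sum of all coordinates.
        exact (lintegral_sub_right_eq_self
          (fun t => F (Fin.snoc (α := fun _ => ℝ) y t)) (∑ i, y i)).symm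
    _ = ∫⁻ s : ℝ, ∫⁻ y : Fin m → ℝ, F (Fin.snoc (α := fun _ => ℝ) y (s - ∑ i, y i)) :=
        (lintegral_lintegral_swap hsn.aemeasurable).symm
    _ = ∫⁻ s in Set.Ioi (0 : ℝ),
          ∫⁻ y : Fin m → ℝ, F (Fin.snoc (α := fun _ => ℝ) y (s - ∑ i, y i)) := by
        refine (setLIntegral_eq_of_support_subset ?_).symm
        intro s hs
        by_contra hs'
        refine hs ?_
        simp only [Set.mem_Ioi, not_lt] at hs'
        simp only [Fin.sum_univ_castSucc] at h0
        simp [h0, hs']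
    _ = _ := by
        refine setLIntegral_congr_fun measurableSet_Ioi fun s hs => ?_
        simp_rw [smul_simplexPoint]
        exact lintegral_eq_pow_mul_lintegral_smul hs
          (f := fun y => F (Fin.snoc (α := fun _ => ℝ) y (s - ∑ i, y i)))
          (hsn.comp measurable_prodMk_left)

/-- The Gamma density of shape `a` and rate `1`, restricted to the open half-line. -/
noncomputable def unitRateGammaPDF (a x : ℝ) : ℝ≥0∞ :=
  (Set.Ioi (0 : ℝ)).indicator
    (fun x => ENNReal.ofReal ((Real.Gamma a)⁻¹ * (x ^ (a - 1) * Real.exp (-x)))) x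

theorem measurable_unitRateGammaPDF (a : ℝ) : Measurable (unitRateGammaPDF a) := by
  unfold unitRateGammaPDF
  exact Measurable.indicator (by fun_prop) measurableSet_Ioi

theorem gammaMeasure_one_eq_withDensity (a : ℝ) :
    gammaMeasure a 1 = (volume : Measure ℝ).withDensity (unitRateGammaPDF a) := by
  refine withDensity_congr_ae ?_
  -- The two densities can differ only at the null point 0, where `gammaPDF` follows the formula for
  -- nonnegative arguments.
  filter_upwards [Measure.ae_ne volume (0 : ℝ)] with x hx
  rcases lt_or_gt_of_ne hx with h | h
  · rw [gammaPDF_of_neg h, unitRateGammaPDF, Set.indicator_of_notMem (by simpa using h.le)]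
  · rw [gammaPDF_of_nonneg h.le, unitRateGammaPDF, Set.indicator_of_mem (by simpa using h)]
    congr 1
    simp
    ring

/-- The sum of independent Gamma variables is independent of their normalized vector: the joint
density factors into a Gamma density of shape `∑ a i` in `s` and the Dirichlet density in `x`. The
exponentials combine to `exp (-s)` because `∑ x i = 1`, and the Jacobian `s ^ m` raises the exponent
`∑ a i - (m + 1)` to `∑ a i - 1`. -/
theorem prod_unitRateGammaPDF_smul {m : ℕ} {a : Fin (m + 1) → ℝ} (ha : ∀ i, 0 < a i)
    {s : ℝ} (hs : 0 < s) (x : Fin (m + 1) → ℝ) (hx : ∑ i, x i = 1) :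
    ENNReal.ofReal (s ^ m) * ∏ i, unitRateGammaPDF (a i) ((s • x) i) =
      ENNReal.ofReal ((Real.Gamma (∑ i, a i))⁻¹ * (s ^ (∑ i, a i - 1) * Real.exp (-s))) *
        dirichletPDF a x := by
  have hA : 0 < ∑ i, a i := Finset.sum_pos (fun i _ => ha i) Finset.univ_nonempty
  have hG := Real.Gamma_pos_of_pos hA
  have hGi := fun i => Real.Gamma_pos_of_pos (ha i)
  unfold dirichletPDF
  split_ifs with h
  · have h1 : ∀ i, unitRateGammaPDF (a i) ((s • x) i) = ENNReal.ofReal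
        ((Real.Gamma (a i))⁻¹ * ((s * x i) ^ (a i - 1) * Real.exp (-(s * x i)))) := fun i => by
      rw [unitRateGammaPDF, Set.indicator_of_mem]
      · rfl
      · exact mul_pos hs (h i)
    have h2 : ∀ i, 0 ≤ (Real.Gamma (a i))⁻¹ * ((s * x i) ^ (a i - 1) * Real.exp (-(s * x i))) :=
      fun i => by have := hGi i; have := h i; positivity
    simp_rw [h1]
    rw [← ENNReal.ofReal_prod_of_nonneg fun i _ => h2 i, ← ENNReal.ofReal_mul (by positivity),
      ← ENNReal.ofReal_mul (by positivity)]
    congr 1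
    have h3 : ∀ i, (s * x i) ^ (a i - 1) = s ^ (a i - 1) * x i ^ (a i - 1) :=
      fun i => Real.mul_rpow hs.le (h i).le
    simp_rw [h3, Finset.prod_mul_distrib]
    rw [← Real.exp_sum, Finset.sum_neg_distrib, ← Finset.mul_sum, hx, mul_one,
      ← Real.rpow_sum_of_pos hs, Finset.prod_inv_distrib, Finset.sum_sub_distrib]
    have h4 : s ^ (∑ i, a i - ∑ _i : Fin (m + 1), (1 : ℝ)) * s ^ m = s ^ (∑ i, a i - 1) := by
      rw [← Real.rpow_natCast, ← Real.rpow_add hs]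
      simp
      ring_nf
    rw [← h4]
    field_simp
  · push Not at h
    obtain ⟨i, hi⟩ := h
    rw [mul_zero, Finset.prod_eq_zero (Finset.mem_univ i), mul_zero]
    rw [unitRateGammaPDF, Set.indicator_of_notMem]
    simpa using mul_nonpos_of_nonneg_of_nonpos hs.le hi

theorem setLIntegral_gamma {a : ℝ} (ha : 0 < a) :
    ∫⁻ s in Set.Ioi (0 : ℝ),
      ENNReal.ofReal ((Real.Gamma a)⁻¹ * (s ^ (a - 1) * Real.exp (-s))) = 1 := by
  rw [← lintegral_indicator measurableSet_Ioi]
  have h := (isProbabilityMeasure_gammaMeasure ha one_pos).measure_univ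
  rw [gammaMeasure_one_eq_withDensity, withDensity_apply _ MeasurableSet.univ,
    Measure.restrict_univ] at h
  exact h

/-- Independent Gamma variables divided by their sum have the Dirichlet distribution. -/
theorem map_div_sum_pi_gammaMeasure {m : ℕ} {a : Fin (m + 1) → ℝ} (ha : ∀ i, 0 < a i) :
    (Measure.pi fun i => gammaMeasure (a i) 1).map (fun g i => g i / ∑ j, g j) =
      dirichletMeasure a := by
  have hA : 0 < ∑ i, a i := Finset.sum_pos (fun i _ => ha i) Finset.univ_nonempty
  have hprob := fun i => isProbabilityMeasure_gammaMeasure (ha i) one_pos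
  simp_rw [gammaMeasure_one_eq_withDensity] at hprob ⊢
  have hD : Measurable fun x : Fin (m + 1) → ℝ => ∏ i, unitRateGammaPDF (a i) (x i) :=
    Finset.measurable_prod _ fun i _ =>
      (measurable_unitRateGammaPDF (a i)).comp (measurable_pi_apply i)
  have hN : Measurable fun (g : Fin (m + 1) → ℝ) i => g i / ∑ j, g j := by fun_prop
  have hdir : Measurable fun y : Fin m → ℝ => dirichletPDF a (simplexPoint y) := by
    refine Measurable.comp (g := dirichletPDF a) ?_ measurable_simplexPoint
    unfold dirichletPDF
    refine Measurable.ite ?_ (by fun_prop) measurable_const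
    simp_rw [Set.ofPred_forall]
    exact MeasurableSet.iInter fun i => measurableSet_lt measurable_const (measurable_pi_apply i)
  refine Measure.ext_of_lintegral _ fun f hf => ?_
  rw [lintegral_map hf hN,
    pi_withDensity fun i => measurable_unitRateGammaPDF (a i),
    lintegral_withDensity_eq_lintegral_mul (g := fun x : Fin (m + 1) → ℝ => f fun i => x i / ∑ j, x j) _ hD
      (hf.comp hN), dirichletMeasure,
    lintegral_map hf measurable_simplexPoint,
    lintegral_withDensity_eq_lintegral_mul (g := fun y => f (simplexPoint y)) _ hdir
      (hf.comp measurable_simplexPoint),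
    lintegral_eq_lintegral_smul_simplexPoint (F := (fun x : Fin (m + 1) → ℝ => ∏ i, unitRateGammaPDF (a i) (x i)) *
      fun x => f fun i => x i / ∑ j, x j) (hD.mul (hf.comp hN))]
  · calc _ = ∫⁻ s in Set.Ioi (0 : ℝ), ENNReal.ofReal ((Real.Gamma (∑ i, a i))⁻¹ *
          (s ^ (∑ i, a i - 1) * Real.exp (-s))) *
          ∫⁻ y : Fin m → ℝ, dirichletPDF a (simplexPoint y) * f (simplexPoint y) := by
          refine setLIntegral_congr_fun measurableSet_Ioi fun s hs => ?_
          have hs : 0 < s := hs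
          rw [← lintegral_const_mul' _ _ ENNReal.ofReal_ne_top,
            ← lintegral_const_mul' _ _ ENNReal.ofReal_ne_top]
          refine lintegral_congr fun y => ?_
          have hn : (fun i => (s • simplexPoint y) i / ∑ j, (s • simplexPoint y) j) =
              simplexPoint y := by
            funext i
            simp [← Finset.mul_sum, sum_simplexPoint, hs.ne']
          simp only [Pi.mul_apply, hn]
          rw [← mul_assoc, prod_unitRateGammaPDF_smul ha hs _ (sum_simplexPoint y), mul_assoc]
      _ = _ := by
          rw [lintegral_mul_const _ (by fun_prop), setLIntegral_gamma hA, one_mul]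
          rfl
  -- A nonpositive sum forces a nonpositive coordinate, whose Gamma density vanishes.
  · intro x hx
    have : ∃ i, x i ≤ 0 := by
      by_contra! h
      exact absurd hx (not_le.2 (Finset.sum_pos (fun i _ => h i) Finset.univ_nonempty))
    obtain ⟨i, hi⟩ := this
    rw [Pi.mul_apply, Finset.prod_eq_zero (Finset.mem_univ i), zero_mul]
    rw [unitRateGammaPDF, Set.indicator_of_notMem (by simpa using hi)]

/-! ### Central limit theorem for weighted sums, by characteristic functions -/

/-- Telescoping: exchange one factor at a time, the remaining factors having norm at most 1. -/
theorem norm_prod_sub_prod_le_sum {ι : Type*} (s : Finset ι) {f g : ι → ℂ}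
    (hf : ∀ i ∈ s, ‖f i‖ ≤ 1) (hg : ∀ i ∈ s, ‖g i‖ ≤ 1) :
    ‖∏ i ∈ s, f i - ∏ i ∈ s, g i‖ ≤ ∑ i ∈ s, ‖f i - g i‖ := by
  classical
  induction s using Finset.induction_on with
  | empty => simp
  | insert a s ha ih =>
    rw [Finset.prod_insert ha, Finset.prod_insert ha, Finset.sum_insert ha]
    have hs := ih (fun i hi => hf i (Finset.mem_insert_of_mem hi))
      fun i hi => hg i (Finset.mem_insert_of_mem hi)
    have hfa := hf a (Finset.mem_insert_self a s)
    have hgs : ‖∏ i ∈ s, g i‖ ≤ 1 := by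
      rw [norm_prod]
      exact Finset.prod_le_one (fun _ _ => norm_nonneg _)
        fun i hi => hg i (Finset.mem_insert_of_mem hi)
    calc ‖f a * ∏ i ∈ s, f i - g a * ∏ i ∈ s, g i‖
        = ‖(f a - g a) * ∏ i ∈ s, g i + f a * (∏ i ∈ s, f i - ∏ i ∈ s, g i)‖ := by
          congr 1
          ring
      _ ≤ ‖f a - g a‖ * ‖∏ i ∈ s, g i‖ + ‖f a‖ * ‖∏ i ∈ s, f i - ∏ i ∈ s, g i‖ := by
          refine (norm_add_le _ _).trans ?_
          rw [norm_mul, norm_mul]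
      _ ≤ ‖f a - g a‖ + ∑ i ∈ s, ‖f i - g i‖ :=
          add_le_add (mul_le_of_le_one_right (norm_nonneg _) hgs)
            ((mul_le_of_le_one_left (norm_nonneg _) hfa).trans hs)

theorem cexp_neg_sq_div_two_sub_isLittleO :
    (fun t : ℝ => Complex.exp (-((t : ℂ) ^ 2 / 2)) - (1 - (t : ℂ) ^ 2 / 2)) =o[𝓝 0]
      fun t => t ^ 2 := by
  have h := (hasDerivAt_iff_isLittleO_nhds_zero.1 (Complex.hasDerivAt_exp 0))
  have ht : Tendsto (fun t : ℝ => -((t : ℂ) ^ 2 / 2)) (𝓝 0) (𝓝 0) := by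
    have : Continuous fun t : ℝ => -((t : ℂ) ^ 2 / 2) := by fun_prop
    simpa using this.tendsto 0
  have h2 := h.comp_tendsto ht
  have h3 : (fun t : ℝ => -((t : ℂ) ^ 2 / 2)) =O[𝓝 0] fun t : ℝ => t ^ 2 := by
    refine Asymptotics.IsBigO.of_bound 1 (Eventually.of_forall fun t => ?_)
    simp only [norm_neg, norm_div, norm_pow, Complex.norm_real, one_mul]
    norm_num
    positivity
  refine (h2.trans_isBigO h3).congr_left fun t => ?_
  simp
  ring

section WeightedSums

variable {Ω : Type*} {mΩ : MeasurableSpace Ω} {P : Measure Ω} [IsProbabilityMeasure P]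

/-- A Lindeberg-type central limit theorem for weighted sums of i.i.d. standardized variables. -/
theorem tendsto_charFun_weighted_sum {Z : ℕ → Ω → ℝ} (hindep : iIndepFun Z P)
    (hident : ∀ i, IdentDistrib (Z i) (Z 0) P P) (h0 : P[Z 0] = 0) (h1 : P[Z 0 ^ 2] = 1)
    {w : ℕ → ℕ → ℝ} {v : ℝ}
    (hmax : ∀ δ > 0, ∀ᶠ n in atTop, ∀ i ∈ Finset.range (n + 1), |w n i| ≤ δ)
    (hsum : Tendsto (fun n => ∑ i ∈ Finset.range (n + 1), w n i ^ 2) atTop (𝓝 v)) (t : ℝ) :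
    Tendsto (fun n => charFun (P.map fun ω => ∑ i ∈ Finset.range (n + 1), w n i * Z i ω) t)
      atTop (𝓝 (Complex.exp (-(v * t ^ 2 / 2)))) := by
  have mZ := fun i => (hident i).aemeasurable_fst
  have : IsProbabilityMeasure (P.map (Z 0)) := Measure.isProbabilityMeasure_map (mZ 0)
  set φ := charFun (P.map (Z 0)) with hφ
  have hchar : ∀ n, charFun (P.map fun ω => ∑ i ∈ Finset.range (n + 1), w n i * Z i ω) t =
      ∏ i ∈ Finset.range (n + 1), φ (w n i * t) := fun n => by
    have hi : iIndepFun (fun i ω => w n i * Z i ω) P :=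
      hindep.comp (fun i x => w n i * x) fun i => by fun_prop
    rw [(hi.restrict _).charFun_map_fun_finsetSum_eq_prod fun i _ => (mZ i).const_mul _,
      Finset.prod_apply]
    refine Finset.prod_congr rfl fun i _ => ?_
    rw [charFun_map_mul_comp (mZ i), (hident i).map_eq]
  set ψ : ℝ → ℂ := fun u => Complex.exp (-((u : ℂ) ^ 2 / 2)) with hψ
  have hψ1 : ∀ u, ‖ψ u‖ ≤ 1 := fun u => by
    have : -((u : ℂ) ^ 2 / 2) = ((-(u ^ 2 / 2) : ℝ) : ℂ) := by push_cast; ring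
    rw [hψ]
    simp only
    rw [this, Complex.norm_exp_ofReal]
    exact Real.exp_le_one_iff.2 (by nlinarith [sq_nonneg u])
  have hψprod : ∀ n, ∏ i ∈ Finset.range (n + 1), ψ (w n i * t) =
      Complex.exp (-(((∑ i ∈ Finset.range (n + 1), w n i ^ 2 : ℝ) : ℂ) * t ^ 2 / 2)) := fun n => by
    rw [hψ, ← Complex.exp_sum]
    congr 1
    push_cast
    rw [Finset.sum_neg_distrib, Finset.sum_mul, Finset.sum_div]
    congr 1
    exact Finset.sum_congr rfl fun i _ => by ring
  have hψlim : Tendsto (fun n => ∏ i ∈ Finset.range (n + 1), ψ (w n i * t)) atTop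
      (𝓝 (Complex.exp (-(v * t ^ 2 / 2)))) := by
    simp_rw [hψprod]
    have hc : Continuous fun r : ℝ => Complex.exp (-((r : ℂ) * t ^ 2 / 2)) := by fun_prop
    exact (hc.tendsto v).comp hsum
  -- Standardization gives `φ` the same second-order expansion `1 - u ^ 2 / 2` as `ψ`.
  have hlo : (fun u => φ u - ψ u) =o[𝓝 0] fun u => u ^ 2 := by
    refine ((taylor_charFun_two (mZ 0) h0 h1).sub cexp_neg_sq_div_two_sub_isLittleO).congr_left
      fun u => ?_
    simp [hφ, hψ]
  have hdiff : Tendsto (fun n => ∏ i ∈ Finset.range (n + 1), φ (w n i * t) -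
      ∏ i ∈ Finset.range (n + 1), ψ (w n i * t)) atTop (𝓝 0) := by
    have hbd : ∀ᶠ n in atTop, ∑ i ∈ Finset.range (n + 1), w n i ^ 2 ≤ |v| + 1 :=
      (hsum.eventually (gt_mem_nhds (lt_of_le_of_lt (le_abs_self v) (lt_add_one _)))).mono
        fun _ h => le_of_lt h
    rw [Metric.tendsto_nhds]
    intro ε hε
    -- `C` eventually dominates `t ^ 2 * ∑ w n i ^ 2`; the summand 1 keeps it positive when `t = 0`.
    set C := (|v| + 1) * t ^ 2 + 1 with hC
    have hCpos : 0 < C := by positivity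
    have hη : 0 < ε / (2 * C) := by positivity
    obtain ⟨δ, hδ, hδφ⟩ := Metric.eventually_nhds_iff.1 (hlo.def hη)
    have hδt : 0 < δ / (2 * (|t| + 1)) := by positivity
    filter_upwards [hbd, hmax _ hδt] with n hn hw
    rw [dist_zero_right]
    calc _ ≤ ∑ i ∈ Finset.range (n + 1), ‖φ (w n i * t) - ψ (w n i * t)‖ :=
          norm_prod_sub_prod_le_sum _ (fun i _ => norm_charFun_le_one _) fun i _ => hψ1 _
      _ ≤ ∑ i ∈ Finset.range (n + 1), ε / (2 * C) * (w n i ^ 2 * t ^ 2) := by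
          refine Finset.sum_le_sum fun i hi => ?_
          refine (hδφ ?_).trans_eq ?_
          · rw [dist_zero_right, Real.norm_eq_abs, abs_mul]
            calc |w n i| * |t| ≤ δ / (2 * (|t| + 1)) * (|t| + 1) := by
                  gcongr
                  · exact hw i hi
                  · linarith
              _ = δ / 2 := by
                  have : |t| + 1 ≠ 0 := by positivity
                  field_simp
              _ < δ := half_lt_self hδ
          · rw [Real.norm_of_nonneg (sq_nonneg _), mul_pow]
      _ = ε / (2 * C) * ((∑ i ∈ Finset.range (n + 1), w n i ^ 2) * t ^ 2) := by
          rw [Finset.sum_mul, Finset.mul_sum]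
      _ ≤ ε / (2 * C) * C := by
          gcongr
          rw [hC]
          nlinarith [mul_le_mul_of_nonneg_right hn (sq_nonneg t)]
      _ = ε / 2 := by field_simp
      _ < ε := half_lt_self hε
  simp_rw [hchar]
  simpa using hdiff.add hψlim

end WeightedSums

/-! ### Moments of the Gamma distribution -/

theorem ae_pos_gammaMeasure_one (a : ℝ) : ∀ᵐ x ∂(gammaMeasure a 1), 0 < x := by
  rw [gammaMeasure_one_eq_withDensity, ae_withDensity_iff (measurable_unitRateGammaPDF a)]
  refine Eventually.of_forall fun x hx => ?_
  by_contra h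
  exact hx (Set.indicator_of_notMem h _)

/-- Multiplying the density of shape `a` by `x ^ k` gives a multiple of the density of shape `a +
k`, which has mass 1. -/
theorem lintegral_pow_gammaMeasure_one {a : ℝ} (ha : 0 < a) (k : ℕ) :
    ∫⁻ x, ENNReal.ofReal (x ^ k) ∂(gammaMeasure a 1) =
      ENNReal.ofReal (Real.Gamma (a + k) / Real.Gamma a) := by
  have hk : 0 < a + k := by positivity
  have hGa := Real.Gamma_pos_of_pos ha
  have hGk := Real.Gamma_pos_of_pos hk
  rw [gammaMeasure_one_eq_withDensity, lintegral_withDensity_eq_lintegral_mul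
    (g := fun x => ENNReal.ofReal (x ^ k)) _ (measurable_unitRateGammaPDF a) (by fun_prop)]
  have h : ∀ x : ℝ, unitRateGammaPDF a x * ENNReal.ofReal (x ^ k) =
      ENNReal.ofReal (Real.Gamma (a + k) / Real.Gamma a) * unitRateGammaPDF (a + k) x := fun x => by
    by_cases hx : 0 < x
    · rw [unitRateGammaPDF, unitRateGammaPDF, Set.indicator_of_mem (by exact hx),
        Set.indicator_of_mem (by exact hx), ← ENNReal.ofReal_mul (by positivity),
        ← ENNReal.ofReal_mul (by positivity)]
      congr 1
      rw [show a + k - 1 = (a - 1) + k by ring, Real.rpow_add hx, Real.rpow_natCast]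
      field_simp
    · rw [unitRateGammaPDF, unitRateGammaPDF, Set.indicator_of_notMem (by exact hx),
        Set.indicator_of_notMem (by exact hx), zero_mul, mul_zero]
  simp only [Pi.mul_apply, h]
  rw [lintegral_const_mul _ (measurable_unitRateGammaPDF _)]
  unfold unitRateGammaPDF
  rw [lintegral_indicator measurableSet_Ioi, setLIntegral_gamma hk, mul_one]

theorem integral_pow_gammaMeasure_one {a : ℝ} (ha : 0 < a) (k : ℕ) :
    ∫ x, x ^ k ∂(gammaMeasure a 1) = Real.Gamma (a + k) / Real.Gamma a := by
  have hG := Real.Gamma_pos_of_pos ha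
  have hGk := Real.Gamma_pos_of_pos (show 0 < a + k by positivity)
  rw [integral_eq_lintegral_of_nonneg_ae, lintegral_pow_gammaMeasure_one ha,
    ENNReal.toReal_ofReal (by positivity)]
  · filter_upwards [ae_pos_gammaMeasure_one a] with x hx using pow_nonneg hx.le k
  · fun_prop

theorem integrable_pow_gammaMeasure_one {a : ℝ} (ha : 0 < a) (k : ℕ) :
    Integrable (fun x => x ^ k) (gammaMeasure a 1) := by
  -- The integral of a nonintegrable function is 0 by convention, so a nonzero value proves
  -- integrability.
  refine Integrable.of_integral_ne_zero ?_
  rw [integral_pow_gammaMeasure_one ha]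
  have hG := Real.Gamma_pos_of_pos ha
  have hGk := Real.Gamma_pos_of_pos (show 0 < a + k by positivity)
  positivity

theorem integral_id_gammaMeasure_one {a : ℝ} (ha : 0 < a) : ∫ x, x ∂(gammaMeasure a 1) = a := by
  have h := integral_pow_gammaMeasure_one ha 1
  have hG := Real.Gamma_pos_of_pos ha
  simpa [Real.Gamma_add_one ha.ne', hG.ne'] using h

theorem integral_sq_gammaMeasure_one {a : ℝ} (ha : 0 < a) :
    ∫ x, x ^ 2 ∂(gammaMeasure a 1) = a ^ 2 + a := by
  have h := integral_pow_gammaMeasure_one ha 2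
  have hG := Real.Gamma_pos_of_pos ha
  rw [h, show a + (2 : ℕ) = (a + 1) + 1 by push_cast; ring,
    Real.Gamma_add_one (by positivity : a + 1 ≠ 0), Real.Gamma_add_one ha.ne']
  field_simp

theorem isProbabilityMeasure_dirichletMeasure {m : ℕ} {a : Fin (m + 1) → ℝ} (ha : ∀ i, 0 < a i) :
    IsProbabilityMeasure (dirichletMeasure a) := by
  have := fun i => isProbabilityMeasure_gammaMeasure (ha i) one_pos
  rw [← map_div_sum_pi_gammaMeasure ha]
  exact Measure.isProbabilityMeasure_map (by fun_prop)

/-! ### Deterministic sequences with convergent averages -/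

section Averages

variable {x : ℕ → ℝ}

theorem tendsto_inv_sqrt_add_one : Tendsto (fun n : ℕ => (√((n : ℝ) + 1))⁻¹) atTop (𝓝 0) :=
  tendsto_inv_atTop_zero.comp (Real.tendsto_sqrt_atTop.comp
    (tendsto_atTop_add_const_right _ _ tendsto_natCast_atTop_atTop))

theorem tendsto_shifted_average {m : ℝ}
    (h : Tendsto (fun n : ℕ => (∑ i ∈ Finset.range n, x i) / n) atTop (𝓝 m)) :
    Tendsto (fun n : ℕ => (∑ i ∈ Finset.range (n + 1), x i) / ((n : ℝ) + 1)) atTop (𝓝 m) := by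
  simpa using (tendsto_add_atTop_iff_nat 1).2 h

/-- The term is the difference of the averages over `n + 1` and `n` terms, the latter multiplied by
`n / (n + 1)`. -/
theorem tendsto_div_add_one_of_average {m : ℝ}
    (h : Tendsto (fun n : ℕ => (∑ i ∈ Finset.range n, x i) / n) atTop (𝓝 m)) :
    Tendsto (fun n : ℕ => x n / ((n : ℝ) + 1)) atTop (𝓝 0) := by
  have h1 := (tendsto_shifted_average h).sub (h.mul (tendsto_natCast_div_add_atTop (1 : ℝ)))
  rw [mul_one, sub_self] at h1
  refine h1.congr fun n => ?_
  rw [Finset.sum_range_succ]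
  rcases eq_or_ne n 0 with rfl | hn
  · simp
  · have : (n : ℝ) ≠ 0 := by exact_mod_cast hn
    field_simp
    ring

/-- Convergent averages of squares force `x i ^ 2 = o(i)`. Indices beyond some `K` then obey the
bound by themselves, and the finitely many earlier terms are absorbed by the growth of `√(n + 1)`.
This supplies the uniform negligibility of the weights. -/
theorem eventually_forall_abs_le_mul_sqrt {s : ℝ}
    (h : Tendsto (fun n : ℕ => (∑ i ∈ Finset.range n, x i ^ 2) / n) atTop (𝓝 s))
    {δ : ℝ} (hδ : 0 < δ) :
    ∀ᶠ n : ℕ in atTop, ∀ i ∈ Finset.range (n + 1), |x i| ≤ δ * √((n : ℝ) + 1) := by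
  have h1 := tendsto_div_add_one_of_average h
  obtain ⟨K, hK⟩ := eventually_atTop.1 (h1.eventually (ge_mem_nhds (show 0 < δ ^ 2 by positivity)))
  have h2 := (tendsto_inv_sqrt_add_one.const_mul (∑ i ∈ Finset.range K, |x i|))
  rw [mul_zero] at h2
  filter_upwards [h2.eventually (ge_mem_nhds hδ)] with n hn i hi
  have hsq : 0 < √((n : ℝ) + 1) := by positivity
  rw [← div_eq_mul_inv, div_le_iff₀ hsq] at hn
  rcases lt_or_ge i K with hiK | hiK
  · exact (Finset.single_le_sum (f := fun i => |x i|) (fun _ _ => abs_nonneg _)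
      (Finset.mem_range.2 hiK)).trans hn
  · have h3 := hK i hiK
    rw [div_le_iff₀ (by positivity)] at h3
    have hin : (i : ℝ) ≤ n := by exact_mod_cast Nat.lt_succ_iff.1 (Finset.mem_range.1 hi)
    refine abs_le_of_sq_le_sq ?_ (by positivity)
    rw [mul_pow, Real.sq_sqrt (by positivity)]
    exact h3.trans (by gcongr)

theorem sampleMean_eq_sum_range (n : ℕ) (x : ℕ → ℝ) :
    sampleMean n x = (∑ i ∈ Finset.range (n + 1), x i) / ((n : ℝ) + 1) := by
  rw [sampleMean, Finset.sum_range]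

theorem tendsto_sampleMean {m : ℝ}
    (h : Tendsto (fun n : ℕ => (∑ i ∈ Finset.range n, x i) / n) atTop (𝓝 m)) :
    Tendsto (fun n => sampleMean n x) atTop (𝓝 m) := by
  simp_rw [sampleMean_eq_sum_range]
  exact tendsto_shifted_average h

theorem sum_sub_sampleMean (n : ℕ) (x : ℕ → ℝ) :
    ∑ i ∈ Finset.range (n + 1), (x i - sampleMean n x) = 0 := by
  have : (n : ℝ) + 1 ≠ 0 := by positivity
  rw [Finset.sum_sub_distrib, sampleMean_eq_sum_range]
  simp
  field_simp
  simp

theorem sum_sub_sampleMean_sq (n : ℕ) (x : ℕ → ℝ) :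
    (∑ i ∈ Finset.range (n + 1), (x i - sampleMean n x) ^ 2) / ((n : ℝ) + 1) =
      (∑ i ∈ Finset.range (n + 1), x i ^ 2) / ((n : ℝ) + 1) - sampleMean n x ^ 2 := by
  have hn : (n : ℝ) + 1 ≠ 0 := by positivity
  have h : ∑ i ∈ Finset.range (n + 1), x i = ((n : ℝ) + 1) * sampleMean n x := by
    rw [sampleMean_eq_sum_range]
    field_simp
  simp_rw [sub_sq, Finset.sum_add_distrib, Finset.sum_sub_distrib, ← Finset.sum_mul,
    ← Finset.mul_sum, h]
  simp
  field_simp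
  ring

/-- The centered and rescaled sample, as weights for standardized Gamma variables of shape `a`. -/
noncomputable def centeredWeight (a : ℝ) (x : ℕ → ℝ) (n i : ℕ) : ℝ :=
  √a * (x i - sampleMean n x) * (√((n : ℝ) + 1))⁻¹

/-- The sum is exactly `a` times the empirical variance. -/
theorem tendsto_sum_centeredWeight_sq {a m s : ℝ} (ha : 0 < a)
    (h1 : Tendsto (fun n : ℕ => (∑ i ∈ Finset.range n, x i) / n) atTop (𝓝 m))
    (h2 : Tendsto (fun n : ℕ => (∑ i ∈ Finset.range n, x i ^ 2) / n) atTop (𝓝 (m ^ 2 + s))) :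
    Tendsto (fun n => ∑ i ∈ Finset.range (n + 1), centeredWeight a x n i ^ 2) atTop
      (𝓝 (a * s)) := by
  have h3 := ((tendsto_shifted_average h2).sub ((tendsto_sampleMean h1).pow 2)).const_mul a
  rw [add_sub_cancel_left] at h3
  refine h3.congr fun n => ?_
  rw [← sum_sub_sampleMean_sq]
  simp_rw [centeredWeight, mul_pow, ← Finset.sum_mul, ← Finset.mul_sum]
  rw [Real.sq_sqrt ha.le, inv_pow, Real.sq_sqrt (by positivity)]
  ring

theorem eventually_forall_abs_centeredWeight_le {a m s : ℝ} (ha : 0 < a)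
    (h1 : Tendsto (fun n : ℕ => (∑ i ∈ Finset.range n, x i) / n) atTop (𝓝 m))
    (h2 : Tendsto (fun n : ℕ => (∑ i ∈ Finset.range n, x i ^ 2) / n) atTop (𝓝 s))
    {δ : ℝ} (hδ : 0 < δ) :
    ∀ᶠ n in atTop, ∀ i ∈ Finset.range (n + 1), |centeredWeight a x n i| ≤ δ := by
  have hsa : 0 < √a := Real.sqrt_pos.2 ha
  -- Half of `δ` is spent on `x i` and half on the sample mean; `√a` cancels the factor in the
  -- weight.
  have hε : 0 < δ / (2 * √a) := by positivity
  have h3 := ((tendsto_sampleMean h1).abs).mul tendsto_inv_sqrt_add_one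
  rw [mul_zero] at h3
  filter_upwards [eventually_forall_abs_le_mul_sqrt h2 hε, h3.eventually (ge_mem_nhds hε)]
    with n hx hm i hi
  have hsq : 0 < √((n : ℝ) + 1) := by positivity
  rw [← div_eq_mul_inv, div_le_iff₀ hsq] at hm
  rw [centeredWeight, abs_mul, abs_mul, abs_of_pos hsa, abs_of_pos (inv_pos.2 hsq),
    ← div_eq_mul_inv, div_le_iff₀ hsq]
  calc √a * |x i - sampleMean n x| ≤ √a * (|x i| + |sampleMean n x|) := by
        gcongr
        exact abs_sub _ _
    _ ≤ √a * (δ / (2 * √a) * √((n : ℝ) + 1) + δ / (2 * √a) * √((n : ℝ) + 1)) := by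
        gcongr
        exact hx i hi
    _ = δ * √((n : ℝ) + 1) := by
        field_simp
        ring

end Averages

/-! ### Gamma sequences and the normalized sum -/

/-- The law of an i.i.d. sequence of Gamma variables of shape `a` and rate `1`. -/
noncomputable def gammaSequence (a : ℝ) : Measure (ℕ → ℝ) :=
  Measure.infinitePi fun _ => gammaMeasure a 1

section GammaSequence

variable {a : ℝ}

theorem isProbabilityMeasure_gammaSequence (ha : 0 < a) :
    IsProbabilityMeasure (gammaSequence a) := by
  have := isProbabilityMeasure_gammaMeasure ha one_pos
  unfold gammaSequence
  infer_instance

theorem map_eval_gammaSequence (ha : 0 < a) (i : ℕ) :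
    (gammaSequence a).map (fun ω => ω i) = gammaMeasure a 1 := by
  have := isProbabilityMeasure_gammaMeasure ha one_pos
  exact Measure.infinitePi_map_eval (fun _ : ℕ => gammaMeasure a 1) i

theorem iIndepFun_gammaSequence (ha : 0 < a) {f : ℝ → ℝ} (hf : Measurable f) :
    iIndepFun (fun (i : ℕ) (ω : ℕ → ℝ) => f (ω i)) (gammaSequence a) := by
  have := isProbabilityMeasure_gammaMeasure ha one_pos
  exact iIndepFun_infinitePi fun _ => hf

theorem identDistrib_gammaSequence (ha : 0 < a) {f : ℝ → ℝ} (hf : Measurable f) (i : ℕ) :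
    IdentDistrib (fun ω : ℕ → ℝ => f (ω i)) (fun ω => f (ω 0)) (gammaSequence a)
      (gammaSequence a) := by
  have h : IdentDistrib (fun ω : ℕ → ℝ => ω i) (fun ω => ω 0) (gammaSequence a)
      (gammaSequence a) :=
    ⟨(measurable_pi_apply i).aemeasurable, (measurable_pi_apply 0).aemeasurable, by
      rw [map_eval_gammaSequence ha, map_eval_gammaSequence ha]⟩
  exact h.comp hf

theorem integral_eval_gammaSequence (ha : 0 < a) (i : ℕ) {f : ℝ → ℝ} (hf : Measurable f) :
    ∫ ω, f (ω i) ∂(gammaSequence a) = ∫ y, f y ∂(gammaMeasure a 1) := by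
  rw [← map_eval_gammaSequence ha i, integral_map (measurable_pi_apply i).aemeasurable
    hf.aestronglyMeasurable]

theorem ae_pos_gammaSequence (ha : 0 < a) : ∀ᵐ (ω : ℕ → ℝ) ∂(gammaSequence a), ∀ i, 0 < ω i := by
  refine ae_all_iff.2 fun i => ?_
  refine ae_of_ae_map (f := fun ω : ℕ → ℝ => ω i) (p := fun y => 0 < y)
    (measurable_pi_apply i).aemeasurable ?_
  rw [map_eval_gammaSequence ha]
  exact ae_pos_gammaMeasure_one a

/-- All Dirichlet vectors are realized from one Gamma sequence, so the strong law can control their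
normalizing sums. -/
theorem map_div_sum_gammaSequence (ha : 0 < a) (n : ℕ) :
    (gammaSequence a).map (fun ω (i : Fin (n + 1)) => ω i / ∑ j : Fin (n + 1), ω j) =
      dirichletMeasure fun _ => a := by
  have := isProbabilityMeasure_gammaMeasure ha one_pos
  have h := Measure.map_infinitePi_infinitePi_of_inj (P := fun _ : ℕ => gammaMeasure a 1)
    (Fin.val_injective (n := n + 1))
  rw [← map_div_sum_pi_gammaMeasure fun _ => ha, ← Measure.infinitePi_eq_pi, ← h,
    Measure.map_map (by fun_prop) (by fun_prop)]
  rfl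

theorem ae_tendsto_average_gammaSequence (ha : 0 < a) :
    ∀ᵐ (ω : ℕ → ℝ) ∂(gammaSequence a),
      Tendsto (fun n : ℕ => (∑ i ∈ Finset.range n, ω i) / n) atTop (𝓝 a) := by
  have hint : Integrable (fun ω : ℕ → ℝ => ω 0) (gammaSequence a) := by
    have h := integrable_pow_gammaMeasure_one ha 1
    simp only [pow_one] at h
    rw [← map_eval_gammaSequence ha 0] at h
    exact h.comp_measurable (measurable_pi_apply 0)
  have h := strong_law_ae_real (fun (i : ℕ) (ω : ℕ → ℝ) => ω i) hint
    (fun i j hij => (iIndepFun_gammaSequence ha measurable_id).indepFun hij)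
    (identDistrib_gammaSequence ha measurable_id)
  have hi : ∫ ω : ℕ → ℝ, ω 0 ∂(gammaSequence a) = a :=
    (integral_eval_gammaSequence ha 0 measurable_id).trans (integral_id_gammaMeasure_one ha)
  rwa [hi] at h

/-- The central limit theorem for Gamma variables with centered weights. -/
theorem tendstoInDistribution_centeredWeight (ha : 0 < a) [IsProbabilityMeasure (gammaSequence a)]
    {x : ℕ → ℝ} {m s : ℝ} (hs : 0 ≤ s)
    (h1 : Tendsto (fun n : ℕ => (∑ i ∈ Finset.range n, x i) / n) atTop (𝓝 m))
    (h2 : Tendsto (fun n : ℕ => (∑ i ∈ Finset.range n, x i ^ 2) / n) atTop (𝓝 (m ^ 2 + s))) :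
    TendstoInDistribution
      (fun (n : ℕ) (ω : ℕ → ℝ) =>
        ∑ i ∈ Finset.range (n + 1), centeredWeight a x n i * ((ω i - a) / √a))
      atTop id (fun _ => gammaSequence a) (gaussianReal 0 (a * s).toNNReal) where
  forall_aemeasurable n := (Finset.measurable_fun_sum _ fun i _ => by
    have := measurable_pi_apply (X := fun _ : ℕ => ℝ) i
    fun_prop).aemeasurable
  tendsto := by
    have := isProbabilityMeasure_gammaMeasure ha one_pos
    have hi1 : Integrable (fun y : ℝ => y) (gammaMeasure a 1) := by
      simpa using integrable_pow_gammaMeasure_one ha 1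
    have hi2 := integrable_pow_gammaMeasure_one ha 2
    have hf : Measurable fun y : ℝ => (y - a) / √a := by fun_prop
    refine ProbabilityMeasure.tendsto_iff_tendsto_charFun.2 fun t => ?_
    have h := tendsto_charFun_weighted_sum (iIndepFun_gammaSequence ha hf)
      (identDistrib_gammaSequence ha hf) ?_ ?_
      (fun δ hδ => eventually_forall_abs_centeredWeight_le ha h1 h2 hδ)
      (tendsto_sum_centeredWeight_sq ha h1 h2) t
    · simp only [ProbabilityMeasure.coe_mk, Measure.map_id]
      rw [charFun_gaussianReal, Real.coe_toNNReal _ (by positivity)]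
      simpa using h
    · rw [integral_eval_gammaSequence ha 0 hf, integral_div, integral_sub hi1 (by simp),
        integral_id_gammaMeasure_one ha]
      simp
    · have := integral_eval_gammaSequence ha 0 (hf.pow_const 2)
      refine this.trans ?_
      have h3 : ∀ y : ℝ, ((y - a) / √a) ^ 2 = (y ^ 2 - 2 * a * y + a ^ 2) / a := fun y => by
        rw [div_pow, Real.sq_sqrt ha.le]
        ring
      simp_rw [h3]
      rw [integral_div, integral_add (f := fun y : ℝ => y ^ 2 - 2 * a * y)
        (hi2.sub (hi1.const_mul _)) (integrable_const _),
        integral_sub hi2 (hi1.const_mul _), integral_const_mul, integral_id_gammaMeasure_one ha,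
        integral_sq_gammaMeasure_one ha]
      simp
      field_simp
      ring

theorem sqrt_mul_weightedMean_sub_sampleMean (ha : 0 < a) (n : ℕ) (x ω : ℕ → ℝ)
    (hω : ∀ i, 0 < ω i) :
    √((n : ℝ) + 1) * (weightedMean (fun i : Fin (n + 1) => ω i / ∑ j : Fin (n + 1), ω j) x -
        sampleMean n x) =
      (∑ i ∈ Finset.range (n + 1), centeredWeight a x n i * ((ω i - a) / √a)) *
        ((∑ i ∈ Finset.range (n + 1), ω i) / ((n : ℝ) + 1))⁻¹ := by
  have hsa : √a ≠ 0 := (Real.sqrt_pos.2 ha).ne'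
  have hsq : 0 < √((n : ℝ) + 1) := by positivity
  have hn : (n : ℝ) + 1 = √((n : ℝ) + 1) ^ 2 := (Real.sq_sqrt (by positivity)).symm
  have hS : 0 < ∑ i ∈ Finset.range (n + 1), ω i := Finset.sum_pos (fun i _ => hω i) (by simp)
  have hw : weightedMean (fun i : Fin (n + 1) => ω i / ∑ j : Fin (n + 1), ω j) x =
      (∑ i ∈ Finset.range (n + 1), ω i * x i) / ∑ i ∈ Finset.range (n + 1), ω i := by
    rw [weightedMean, Finset.sum_range, Finset.sum_range, Finset.sum_div]
    exact Finset.sum_congr rfl fun i _ => by ring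
  have hc : ∑ i ∈ Finset.range (n + 1), centeredWeight a x n i * ((ω i - a) / √a) =
      (∑ i ∈ Finset.range (n + 1), ω i * x i -
        (∑ i ∈ Finset.range (n + 1), ω i) * sampleMean n x) / √((n : ℝ) + 1) := by
    -- The part with the constant factor `a` is isolated here; it vanishes on summation by
    -- `sum_sub_sampleMean`.
    have h : ∀ i, centeredWeight a x n i * ((ω i - a) / √a) =
        (ω i * x i - ω i * sampleMean n x - a * (x i - sampleMean n x)) / √((n : ℝ) + 1) :=
      fun i => by
        rw [centeredWeight]
        field_simp
    simp_rw [h]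
    rw [← Finset.sum_div, Finset.sum_sub_distrib, Finset.sum_sub_distrib, ← Finset.mul_sum,
      sum_sub_sampleMean, mul_zero, sub_zero, Finset.sum_mul]
  rw [hw, hc, inv_div]
  generalize sampleMean n x = M
  generalize √((n : ℝ) + 1) = r at *
  rw [hn]
  field_simp

end GammaSequence

/-! ### Limit theorem for a frozen sample -/

theorem measurable_weightedMean_sub_sampleMean (n : ℕ) :
    Measurable fun z : (ℕ → ℝ) × (Fin (n + 1) → ℝ) =>
      √((n : ℝ) + 1) * (weightedMean z.2 z.1 - sampleMean n z.1) := by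
  unfold weightedMean sampleMean
  fun_prop

theorem isProbabilityMeasure_map_dirichletMeasure {a : ℝ} (ha : 0 < a) (x : ℕ → ℝ) (n : ℕ) :
    IsProbabilityMeasure ((dirichletMeasure fun _ : Fin (n + 1) => a).map fun q =>
      √((n : ℝ) + 1) * (weightedMean q x - sampleMean n x)) := by
  have := isProbabilityMeasure_dirichletMeasure fun _ : Fin (n + 1) => ha
  exact Measure.isProbabilityMeasure_map
    ((measurable_weightedMean_sub_sampleMean n).comp measurable_prodMk_left).aemeasurable

/-- The central limit theorem for Dirichlet weighted means of a deterministic sequence. -/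
theorem tendsto_map_dirichletMeasure {a : ℝ} (ha : 0 < a) {x : ℕ → ℝ} {m s : ℝ} (hs : 0 ≤ s)
    (h1 : Tendsto (fun n : ℕ => (∑ i ∈ Finset.range n, x i) / n) atTop (𝓝 m))
    (h2 : Tendsto (fun n : ℕ => (∑ i ∈ Finset.range n, x i ^ 2) / n) atTop (𝓝 (m ^ 2 + s))) :
    Tendsto (β := ProbabilityMeasure ℝ)
      (fun n : ℕ => ⟨(dirichletMeasure fun _ : Fin (n + 1) => a).map fun q =>
        √((n : ℝ) + 1) * (weightedMean q x - sampleMean n x),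
        isProbabilityMeasure_map_dirichletMeasure ha x n⟩)
      atTop (𝓝 ⟨gaussianReal 0 (s / a).toNNReal, inferInstance⟩) := by
  have := isProbabilityMeasure_gammaSequence ha
  have hY : TendstoInMeasure (gammaSequence a) (fun (n : ℕ) (ω : ℕ → ℝ) =>
      ((∑ i ∈ Finset.range (n + 1), ω i) / ((n : ℝ) + 1))⁻¹) atTop fun _ => a⁻¹ := by
    refine tendstoInMeasure_of_tendsto_ae (fun n => ?_) ?_
    · exact Measurable.aestronglyMeasurable (by fun_prop)
    · filter_upwards [ae_tendsto_average_gammaSequence ha] with ω hω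
      exact (tendsto_shifted_average hω).inv₀ ha.ne'
  -- Slutsky's theorem for the product with the inverse average.
  have h := ((tendstoInDistribution_centeredWeight ha hs h1 h2
    ).continuous_comp_prodMk_of_tendstoInMeasure_const (g := fun z : ℝ × ℝ => z.1 * z.2)
    (by fun_prop) hY fun n => by fun_prop).tendsto
  have hlim : (gaussianReal 0 (a * s).toNNReal).map (fun y => y * a⁻¹) =
      gaussianReal 0 (s / a).toNNReal := by
    rw [gaussianReal_map_mul_const, mul_zero]
    congr 1
    refine NNReal.eq ?_
    rw [NNReal.coe_mul, Real.coe_toNNReal _ (by positivity), Real.coe_toNNReal _ (by positivity)]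
    simp
    field_simp
  have hlim' : (⟨gaussianReal 0 (s / a).toNNReal, inferInstance⟩ : ProbabilityMeasure ℝ) =
      ⟨(gaussianReal 0 (a * s).toNNReal).map fun y => y * a⁻¹,
        Measure.isProbabilityMeasure_map (by fun_prop)⟩ := Subtype.ext hlim.symm
  rw [hlim']
  refine h.congr fun n => Subtype.ext (Eq.symm ?_)
  have hm : Measurable fun q : Fin (n + 1) → ℝ =>
      √((n : ℝ) + 1) * (weightedMean q x - sampleMean n x) :=
    (measurable_weightedMean_sub_sampleMean n).comp measurable_prodMk_left
  simp only
  rw [← map_div_sum_gammaSequence ha n, Measure.map_map hm (by fun_prop)]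
  refine Measure.map_congr ?_
  filter_upwards [ae_pos_gammaSequence ha] with ω hω
  exact sqrt_mul_weightedMean_sub_sampleMean ha n x ω hω

/-! ### Conditioning on the sample -/

section Conditional

variable {Ω β γ δ : Type*} [MeasurableSpace Ω] {mβ : MeasurableSpace β} {mγ : MeasurableSpace γ}
  [MeasurableSpace δ] [StandardBorelSpace δ] [Nonempty δ]

/-- The conditional distribution of `f (X, Y)` given an independent `X` is the law of `f (x, Y)`. -/
theorem condDistrib_ae_eq_map_of_indepFun {μ : Measure Ω} [IsProbabilityMeasure μ]
    {X : Ω → β} {Y : Ω → γ} (hX : Measurable X) (hY : AEMeasurable Y μ) (hXY : IndepFun X Y μ)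
    {f : β × γ → δ} (hf : Measurable f) :
    ∀ᵐ x ∂(μ.map X), condDistrib (fun ω => f (X ω, Y ω)) X μ x =
      (μ.map Y).map fun y => f (x, y) := by
  have := Measure.isProbabilityMeasure_map hY
  set κ : Kernel β δ := (Kernel.id ×ₖ Kernel.const β (μ.map Y)).map f with hκ
  have hκx : ∀ x, κ x = (μ.map Y).map fun y => f (x, y) := fun x => by
    rw [hκ, Kernel.map_apply _ hf, Kernel.prod_apply, Kernel.id_apply, Kernel.const_apply,
      Measure.dirac_prod, Measure.map_map hf measurable_prodMk_left]
    rfl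
  have : IsMarkovKernel κ := Kernel.IsMarkovKernel.map _ hf
  -- Disintegrations are almost everywhere unique, so it suffices that `κ` reproduces the joint law.
  have hae := condDistrib_ae_eq_of_measure_eq_compProd (μ := μ) X
    (Y := fun ω => f (X ω, Y ω)) (hf.comp_aemeasurable (hX.aemeasurable.prodMk hY)) (κ := κ) ?_
  · filter_upwards [hae] with x hx
    rw [hx, hκx]
  · have hg : Measurable fun z : β × γ => (z.1, f z) := measurable_fst.prodMk hf
    have hprod := (indepFun_iff_map_prod_eq_prod_map_map hX.aemeasurable hY).1 hXY
    have : μ.map (fun ω => (X ω, f (X ω, Y ω))) =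
        ((μ.map X).prod (μ.map Y)).map fun z : β × γ => (z.1, f z) := by
      rw [← hprod, AEMeasurable.map_map_of_aemeasurable hg.aemeasurable
        (hX.aemeasurable.prodMk hY)]
      rfl
    rw [this]
    refine Measure.ext_of_lintegral _ fun F hF => ?_
    rw [lintegral_map hF hg, lintegral_prod (fun z : β × γ => F (z.1, f z)) (hF.comp hg).aemeasurable,
      Measure.lintegral_compProd hF]
    refine lintegral_congr fun x => ?_
    rw [hκx, lintegral_map (f := fun b => F (x, b)) (g := fun y => f (x, y))
      (hF.comp measurable_prodMk_left) (hf.comp measurable_prodMk_left)]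

end Conditional

theorem ae_tendsto_average_comp {Ω : Type*} [MeasurableSpace Ω] {μ : Measure Ω}
    {X : ℕ → Ω → ℝ} (hindep : iIndepFun X μ) (hident : ∀ i, IdentDistrib (X i) (X 0) μ μ)
    {f : ℝ → ℝ} (hf : Measurable f) (hint : Integrable (fun ω => f (X 0 ω)) μ) :
    ∀ᵐ ω ∂μ, Tendsto (fun n : ℕ => (∑ i ∈ Finset.range n, f (X i ω)) / n) atTop
      (𝓝 (∫ ω, f (X 0 ω) ∂μ)) :=
  strong_law_ae_real (fun i ω => f (X i ω)) hint
    (fun _ _ hij => (hindep.indepFun hij).comp hf hf) fun i => (hident i).comp hf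

/-- Needed to carry the strong law from `Ω` to the law of the sequence through `ae_map_iff`. -/
theorem measurableSet_tendsto_average {f : ℝ → ℝ} (hf : Measurable f) (c : ℝ) :
    MeasurableSet {x : ℕ → ℝ |
      Tendsto (fun n : ℕ => (∑ i ∈ Finset.range n, f (x i)) / n) atTop (𝓝 c)} :=
  measurableSet_tendsto _ fun n => by fun_prop

/-- The sample size is `n + 1`, `X 0, X 1, …` is the sequence of estimates, and `p n` is the weight
vector used with the sample `X 0, …, X n`. -/
theorem mainTheorem11 {Ω : Type*} [MeasurableSpace Ω] (μ : Measure Ω) [IsProbabilityMeasure μ]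
    (X : ℕ → Ω → ℝ) (hX : ∀ i, Measurable (X i))
    (hindep : iIndepFun X μ) (hident : ∀ i, IdentDistrib (X i) (X 0) μ μ)
    (hL2 : MemLp (X 0) 2 μ) (σ : ℝ) (hσ : variance (X 0) μ = σ ^ 2)
    (α : ℝ) (hα : 0 < α)
    (p : (n : ℕ) → Ω → Fin (n + 1) → ℝ)
    (hp : ∀ n, HasLaw (p n) (dirichletMeasure fun _ : Fin (n + 1) => α) μ)
    (hpX : ∀ n, IndepFun (p n) (fun ω i => X i ω) μ) :
    ∀ᵐ x ∂(μ.map fun ω i => X i ω),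
      Tendsto (β := ProbabilityMeasure ℝ)
        (fun n : ℕ =>
          ⟨condDistrib
              (fun ω => √((n : ℝ) + 1) *
                (weightedMean (p n ω) (fun i => X i ω) - sampleMean n fun i => X i ω))
              (fun ω i => X i ω) μ x, inferInstance⟩)
        atTop (𝓝 ⟨gaussianReal 0 (σ ^ 2 / α).toNNReal, inferInstance⟩) := by
  have hXm : Measurable fun ω i => X i ω := measurable_pi_lambda _ hX
  have hmean := ae_tendsto_average_comp hindep hident measurable_id
    (hL2.integrable one_le_two)
  have hsq := ae_tendsto_average_comp hindep hident (f := fun y => y ^ 2) (by fun_prop)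
    hL2.integrable_sq
  have hvar : ∫ ω, X 0 ω ^ 2 ∂μ = (∫ ω, id (X 0 ω) ∂μ) ^ 2 + σ ^ 2 := by
    have h := variance_eq_sub hL2
    rw [hσ] at h
    simp only [Pi.pow_apply] at h
    simp only [id]
    linarith
  rw [hvar] at hsq
  have hcond : ∀ᵐ x ∂(μ.map fun ω i => X i ω), ∀ n : ℕ,
      condDistrib (fun ω => √((n : ℝ) + 1) *
        (weightedMean (p n ω) (fun i => X i ω) - sampleMean n fun i => X i ω))
        (fun ω i => X i ω) μ x =
      (dirichletMeasure fun _ : Fin (n + 1) => α).map fun q =>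
        √((n : ℝ) + 1) * (weightedMean q x - sampleMean n x) := by
    -- Countably many `n` share one exceptional null set.
    refine ae_all_iff.2 fun n => ?_
    have h := condDistrib_ae_eq_map_of_indepFun hXm (hp n).aemeasurable (hpX n).symm
      (measurable_weightedMean_sub_sampleMean n)
    rwa [(hp n).map_eq] at h
  have hmean' := (ae_map_iff hXm.aemeasurable
    (measurableSet_tendsto_average measurable_id _)).2 hmean
  have hsq' := (ae_map_iff hXm.aemeasurable
    (measurableSet_tendsto_average (f := fun y => y ^ 2) (by fun_prop) _)).2 hsq
  filter_upwards [hmean', hsq', hcond] with x h1 h2 h3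
  refine (tendsto_map_dirichletMeasure hα (sq_nonneg σ) h1 h2).congr fun n => ?_
  exact Subtype.ext (h3 n).symm
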